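/- Let $A$ be a normed $*$-algebra: a complex associative algebra, not necessarily unital, with an involution $*$ and a submultiplicative norm $|\cdot|$ (neither completeness of $A$ nor continuity of the involution is assumed). Let $A_{sa}$ be the set of Hermitian elements of $A$. For $a\in A$ put $r_\lambda(a)=\inf_{n\ge 1}|a^n|^{1/n}$ and $r_\sigma(a)=r_\lambda(a^*a)^{1/2}$. A linear functional $\varphi:A\to\mathbb C$ is *positive* if $\varphi(a^*a)\ge 0$ for all $a\in A$, and *Hermitian* if $\varphi(a^*)=\overline{\varphi(a)}$ for all $a\in A$. A positive linear functional $\varphi$ is *weakly continuous on $A_{sa}$* if for each $b\in A$ the functional $a\mapsto\varphi(b^*ab)$ is continuous on $A_{sa}$. It has *finite variation* if there is $v\ge 0$ with $|\varphi(a)|^2\le v\,\varphi(a^*a)$ for all $a\in A$, and then its *variation* $v(\varphi)$ is the infimum of all such $v$. A *state* is a positive linear functional $\psi$ that is weakly continuous on $A_{sa}$ and has finite variation $v(\psi)=1$; $S(A)$ denotes the convex set of states, and a *pure state* is an extreme point of $S(A)$. A positive linear functional $\varphi_1$ is *subordinate* to $\varphi_2$ if $\lambda\varphi_2-\varphi_1$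 is positive for some real $\lambda\ge 0$. A Hermitian positive linear functional $\varphi$ of finite variation is *indecomposable* if every Hermitian positive linear functional of finite variation that is subordinate to $\varphi$ is a multiple of $\varphi$. A *representation* of $A$ in a (complex) Hilbert space $H$ is a $*$-algebra homomorphism $\pi:A\to B(H)$. It is *$\sigma$-contractive* if $\|\pi(a)\|\le r_\sigma(a)$ for all $a\in A$. It is *irreducible* if it is non-zero and $\{0\}$ and $H$ are the only closed subspaces of $H$ that are invariant under all $\pi(a)$, $a\in A$. Representations $\pi_1,\pi_2$ in $H_1,H_2$ are *spatially equivalent* if there is a unitary operator $U:H_1\to H_2$ with $U\pi_1(a)=\pi_2(a)U$ for all $a\in A$. For a state $\psi$, the *GNS representation* $\pi_\psi$ acts in the Hilbert space $H_\psi$ that is the Hausdorff completion of $A$ with respect to the positive semidefinite form $\langle a,b\rangle_\psi=\psi(b^*a)$; the operator $\pi_\psi(a)$ is the continuous extension of the left translation $b\mapsto ab$ (which is bounded for this form). Then: 1. For every state $\psi$ on $A$, the following conditions are equivalent: (i) $\pi_\psi$ is irreducible; (ii) $\psi$ is indecomposable; (iii) $\psi$ is a pure state. 2. The pure states on $A$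 parametrise the irreducible $\sigma$-contractive representations of $A$ in Hilbert spaces up to spatial equivalence, in the following sense. If $\psi$ is a pure state on $A$, then $\pi_\psi$ is an irreducible $\sigma$-contractive representation of $A$. Conversely, if $\pi$ is an irreducible $\sigma$-contractive representation of $A$ in a Hilbert space, then there exists a pure state $\psi$ on $A$ such that $\pi$ is spatially equivalent to $\pi_\psi$. -/

import Mathlib

open scoped ComplexOrder

noncomputable section

namespace NormedStarAlg

/-! A *normed `*`-algebra* is a complex associative algebra, not necessarily unital, with an
involution and a submultiplicative norm. No completeness, and no continuity of the involution, is
assumed. -/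

section Functionals

variable {A : Type*} [NonUnitalNormedRing A] [NormedSpace ℂ A] [IsScalarTower ℂ A A]
  [SMulCommClass ℂ A A] [StarRing A] [StarModule ℂ A]

/-- `φ` is a positive linear functional: `φ (a* a) ≥ 0` for all `a` (in particular these values
are real). -/
def IsPositive (φ : A →ₗ[ℂ] ℂ) : Prop :=
  ∀ a : A, 0 ≤ φ (star a * a)

/-- `φ` is Hermitian: `φ (a*)` is the complex conjugate of `φ a`. -/
def IsHermitian (φ : A →ₗ[ℂ] ℂ) : Prop :=
  ∀ a : A, φ (star a) = star (φ a)

/-- Weak continuity on the set `A_sa` of Hermitian elements: for every `b`, the functional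
`a ↦ φ (b* a b)` is continuous on `A_sa`. -/
def IsWeaklyContinuousOnSA (φ : A →ₗ[ℂ] ℂ) : Prop :=
  ∀ b : A, ContinuousOn (fun a : A => φ (star b * a * b)) {a : A | IsSelfAdjoint a}

/-- The constants `v ≥ 0` with `|φ a|² ≤ v φ (a* a)` for all `a`. -/
def variationBounds (φ : A →ₗ[ℂ] ℂ) : Set ℝ :=
  {v : ℝ | 0 ≤ v ∧ ∀ a : A, ‖φ a‖ ^ 2 ≤ v * (φ (star a * a)).re}

/-- `φ` has finite variation. -/
def HasFiniteVariation (φ : A →ₗ[ℂ] ℂ) : Prop :=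
  (variationBounds φ).Nonempty

/-- The variation of `φ` (meaningful when `φ` has finite variation). -/
def variation (φ : A →ₗ[ℂ] ℂ) : ℝ :=
  sInf (variationBounds φ)

/-- States on a normed `*`-algebra: positive linear functionals, weakly continuous on `A_sa`, of
finite variation equal to `1`. -/
structure IsState (ψ : A →ₗ[ℂ] ℂ) : Prop where
  positive : IsPositive ψ
  weaklyContinuous : IsWeaklyContinuousOnSA ψ
  finiteVariation : HasFiniteVariation ψ
  variation_eq_one : variation ψ = 1

/-- The set `S(A)` of states. -/
def stateSet (A : Type*) [NonUnitalNormedRing A] [NormedSpace ℂ A] [IsScalarTower ℂ A A]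
    [SMulCommClass ℂ A A] [StarRing A] [StarModule ℂ A] : Set (A →ₗ[ℂ] ℂ) :=
  {ψ | IsState ψ}

/-- Pure states: the extreme points of `S(A)`. -/
def IsPureState (ψ : A →ₗ[ℂ] ℂ) : Prop :=
  ψ ∈ (stateSet A).extremePoints ℝ

theorem IsPureState.isState {ψ : A →ₗ[ℂ] ℂ} (h : IsPureState ψ) : IsState ψ := h.1

/-- `φ₁` is subordinate to `φ₂`: `r φ₂ - φ₁` is positive for some real `r ≥ 0`. -/
def IsSubordinate (φ₁ φ₂ : A →ₗ[ℂ] ℂ) : Prop :=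
  ∃ r : ℝ, 0 ≤ r ∧ IsPositive ((r : ℂ) • φ₂ - φ₁)

/-- A Hermitian positive linear functional `φ` of finite variation is indecomposable if every
Hermitian positive linear functional of finite variation that is subordinate to `φ` is a multiple
of `φ`. -/
structure IsIndecomposable (φ : A →ₗ[ℂ] ℂ) : Prop where
  positive : IsPositive φ
  hermitian : IsHermitian φ
  finiteVariation : HasFiniteVariation φ
  eq_smul : ∀ φ₁ : A →ₗ[ℂ] ℂ, IsPositive φ₁ → IsHermitian φ₁ → HasFiniteVariation φ₁ →
    IsSubordinate φ₁ φ → ∃ z : ℂ, φ₁ = z • φ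

end Functionals

section Ptak

variable {A : Type*} [NonUnitalNormedRing A]

/-- `powSucc a n` is the power `a ^ (n + 1)`; the algebra need not have a unit. -/
def powSucc (a : A) : ℕ → A
  | 0 => a
  | n + 1 => powSucc a n * a

/-- `r_λ(a) = inf_{n ≥ 1} ‖aⁿ‖^{1/n}`. -/
def rLambda (a : A) : ℝ :=
  ⨅ n : ℕ, ‖powSucc a n‖ ^ (1 / ((n : ℝ) + 1))

/-- The Pták function `r_σ(a) = r_λ(a* a)^{1/2}`. -/
def rSigma [StarRing A] (a : A) : ℝ :=
  Real.sqrt (rLambda (star a * a))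

end Ptak

section Representations

variable {A : Type*} [NonUnitalNormedRing A] [NormedSpace ℂ A] [StarRing A]
  {H : Type*} [NormedAddCommGroup H] [InnerProductSpace ℂ H] [CompleteSpace H]
  {K : Type*} [NormedAddCommGroup K] [InnerProductSpace ℂ K] [CompleteSpace K]

/-! A representation of `A` in a Hilbert space `H` is a `*`-homomorphism `A →⋆ₙₐ[ℂ] (H →L[ℂ] H)`. -/

/-- A representation is irreducible if it is non-zero and its only closed invariant subspaces are
`{0}` and `H`. -/
def IsIrreducible (π : A →⋆ₙₐ[ℂ] (H →L[ℂ] H)) : Prop :=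
  (∃ a : A, π a ≠ 0) ∧
    ∀ M : Submodule ℂ H, IsClosed (M : Set H) → (∀ a : A, ∀ x ∈ M, π a x ∈ M) →
      M = ⊥ ∨ M = ⊤

/-- `π` is σ-contractive: `‖π a‖ ≤ r_σ(a)` for all `a`. -/
def IsSigmaContractive (π : A →⋆ₙₐ[ℂ] (H →L[ℂ] H)) : Prop :=
  ∀ a : A, ‖π a‖ ≤ rSigma a

/-- Spatial equivalence: there is a unitary operator `U : H → K` with `U π₁(a) = π₂(a) U`. -/
def SpatiallyEquivalent (π₁ : A →⋆ₙₐ[ℂ] (H →L[ℂ] H)) (π₂ : A →⋆ₙₐ[ℂ] (K →L[ℂ] K)) : Prop :=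
  ∃ U : H ≃ₗᵢ[ℂ] K, ∀ (a : A) (x : H), U (π₁ a x) = π₂ a (U x)

end Representations

/-! ### The GNS construction -/

section GNS

variable {A : Type*} [NonUnitalNormedRing A] [NormedSpace ℂ A] [IsScalarTower ℂ A A]
  [SMulCommClass ℂ A A] [StarRing A] [StarModule ℂ A] {φ : A →ₗ[ℂ] ℂ}

/-- The form `(a, b) ↦ φ (a* b)` is Hermitian (by polarisation). -/
theorem IsPositive.form_symm (hφ : IsPositive φ) (a b : A) :
    star (φ (star b * a)) = φ (star a * b) := by
  have him : ∀ c : A, (φ (star c * c)).im = 0 := fun c =>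
    ((Complex.le_def.mp (hφ c)).2).symm
  have h1 := him (a + b)
  have h2 := him (a + Complex.I • b)
  have ha := him a
  have hb := him b
  simp only [star_add, star_smul, add_mul, mul_add, map_add, smul_mul_assoc, mul_smul_comm,
    map_smul, smul_eq_mul, Complex.add_im, Complex.mul_im, Complex.mul_re, Complex.star_def,
    Complex.conj_I, Complex.neg_re, Complex.neg_im, Complex.I_re, Complex.I_im] at h1 h2
  apply Complex.ext
  · simp only [Complex.star_def, Complex.conj_re]
    linarith
  · simp only [Complex.star_def, Complex.conj_im]
    linarith

set_option linter.unusedVariables false in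
/-- The algebra `A`, to be equipped with the semi-inner product of the positive functional `φ`. -/
@[nolint unusedArguments]
def PreGNS (hφ : IsPositive φ) : Type _ := A

instance (hφ : IsPositive φ) : AddCommGroup (PreGNS hφ) := inferInstanceAs (AddCommGroup A)
instance (hφ : IsPositive φ) : Module ℂ (PreGNS hφ) := inferInstanceAs (Module ℂ A)

/-- The identity map from `A` to `PreGNS`. -/
def toPreGNS (hφ : IsPositive φ) : A ≃ₗ[ℂ] PreGNS hφ := LinearEquiv.refl ℂ A

/-- The semi-inner product `(a, b) ↦ φ (a* b)`, conjugate-linear in the first variable. -/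
@[reducible]
def preGNSCore (hφ : IsPositive φ) : PreInnerProductSpace.Core ℂ (PreGNS hφ) where
  inner a b := φ (star ((toPreGNS hφ).symm a) * (toPreGNS hφ).symm b)
  conj_inner_symm a b := hφ.form_symm _ _
  re_inner_nonneg a := (Complex.le_def.mp (hφ ((toPreGNS hφ).symm a))).1
  add_left a b c := by rw [map_add, star_add, add_mul, map_add]
  smul_left a b r := by simp [smul_mul_assoc]

instance (hφ : IsPositive φ) : SeminormedAddCommGroup (PreGNS hφ) :=
  InnerProductSpace.Core.toSeminormedAddCommGroup (c := preGNSCore hφ)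
instance (hφ : IsPositive φ) : InnerProductSpace ℂ (PreGNS hφ) :=
  InnerProductSpace.ofCore (preGNSCore hφ)

theorem preGNS_inner (hφ : IsPositive φ) (a b : A) :
    inner ℂ (toPreGNS hφ a) (toPreGNS hφ b) = φ (star a * b) := rfl

theorem preGNS_norm_sq (hφ : IsPositive φ) (a : A) :
    ‖toPreGNS hφ a‖ ^ 2 = (φ (star a * a)).re := by
  rw [← preGNS_inner hφ, ← RCLike.re_eq_complex_re, ← norm_sq_eq_re_inner]

/-- The Hilbert space `H_φ`: the Hausdorff completion of `A` for the semi-inner product of `φ`.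
It is the completion of the quotient of `A` by the isotropic subspace. -/
abbrev GNSSpace (hφ : IsPositive φ) : Type _ := UniformSpace.Completion (PreGNS hφ)

/-- Left translations are bounded for the semi-inner product of `φ`. -/
theorem preGNS_norm_mul_le (hφ : IsPositive φ) (hc : IsWeaklyContinuousOnSA φ) (a b : A) :
    ‖toPreGNS hφ (a * b)‖ ≤ Real.sqrt ‖star a * a‖ * ‖toPreGNS hφ b‖ := by
  set s : ℝ := (φ (star b * b)).re with hs
  have hs0 : 0 ≤ s := (Complex.le_def.mp (hφ b)).1
  let h : ℕ → A := fun n => Nat.rec (star a * a) (fun _ x => x * x) n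
  have h_zero : h 0 = star a * a := rfl
  have h_succ : ∀ n, h (n + 1) = h n * h n := fun _ => rfl
  have h_sa : ∀ n, star (h n) = h n := by
    intro n
    induction n with
    | zero => simp [h_zero]
    | succ n ih => rw [h_succ, star_mul, ih]
  have h_norm : ∀ n, ‖h n‖ ≤ ‖star a * a‖ ^ (2 ^ n) := by
    intro n
    induction n with
    | zero => simp [h_zero]
    | succ n ih =>
      calc ‖h (n + 1)‖ ≤ ‖h n‖ * ‖h n‖ := norm_mul_le _ _
        _ ≤ ‖star a * a‖ ^ (2 ^ n) * ‖star a * a‖ ^ (2 ^ n) := by gcongr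
        _ = ‖star a * a‖ ^ (2 ^ (n + 1)) := by rw [← pow_add]; congr 1; ring
  let q : ℕ → ℝ := fun n => (φ (star b * h n * b)).re
  have q_zero : q 0 = ‖toPreGNS hφ (a * b)‖ ^ 2 := by
    rw [preGNS_norm_sq]
    simp only [q, h_zero, star_mul, mul_assoc]
  have q_step : ∀ n, q n ^ 2 ≤ s * q (n + 1) := by
    intro n
    have e1 : φ (star b * h n * b) = inner ℂ (toPreGNS hφ b) (toPreGNS hφ (h n * b)) := by
      rw [preGNS_inner, mul_assoc]
    have e2 : q (n + 1) = ‖toPreGNS hφ (h n * b)‖ ^ 2 := by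
      rw [preGNS_norm_sq]
      simp only [q, h_succ, star_mul, h_sa, mul_assoc]
    have e3 : s = ‖toPreGNS hφ b‖ ^ 2 := (preGNS_norm_sq hφ b).symm
    have e4 : |q n| ≤ ‖toPreGNS hφ b‖ * ‖toPreGNS hφ (h n * b)‖ :=
      (Complex.abs_re_le_norm _).trans (e1 ▸ norm_inner_le_norm _ _)
    rw [e2, e3, ← mul_pow, ← sq_abs]
    gcongr
  obtain ⟨c, hc0, hcb⟩ : ∃ c : ℝ, 0 ≤ c ∧ ∀ x : A, star x = x → ‖φ (star b * x * b)‖ ≤ c * ‖x‖ := by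
    have h0 := hc b 0 (IsSelfAdjoint.zero A)
    rw [Metric.continuousWithinAt_iff] at h0
    obtain ⟨δ, hδ, hd⟩ := h0 1 one_pos
    refine ⟨2 / δ, by positivity, fun x hx => ?_⟩
    rcases eq_or_ne x 0 with rfl | hx0
    · simp
    have hxn : 0 < ‖x‖ := norm_pos_iff.mpr hx0
    set t : ℝ := δ / (2 * ‖x‖) with ht
    have ht0 : 0 < t := by positivity
    have hsa : IsSelfAdjoint ((t : ℂ) • x) := by
      change star ((t : ℂ) • x) = _
      rw [star_smul, hx, Complex.star_def, Complex.conj_ofReal]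
    have hdist : dist ((t : ℂ) • x) 0 < δ := by
      rw [dist_zero_right, norm_smul, Complex.norm_real, Real.norm_of_nonneg ht0.le, ht]
      field_simp
      linarith
    have := hd hsa hdist
    simp only [mul_smul_comm, smul_mul_assoc, map_smul, smul_eq_mul, mul_zero, zero_mul, map_zero,
      dist_zero_right, norm_mul, Complex.norm_real, Real.norm_of_nonneg ht0.le] at this
    rw [ht] at this
    have h3 : ‖φ (star b * x * b)‖ < (2 * ‖x‖) / δ := by
      rw [lt_div_iff₀ hδ]
      rw [div_mul_eq_mul_div, div_lt_one (by positivity)] at this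
      linarith
    calc _ ≤ (2 * ‖x‖) / δ := h3.le
      _ = 2 / δ * ‖x‖ := by ring
  have q_le : ∀ n, q n ≤ c * ‖star a * a‖ ^ (2 ^ n) := fun n =>
    ((Complex.re_le_norm _).trans (hcb _ (h_sa n))).trans
      (mul_le_mul_of_nonneg_left (h_norm n) hc0)
  have q0_nonneg : 0 ≤ q 0 := by rw [q_zero]; positivity
  have key : q 0 ≤ ‖star a * a‖ * s := by
    rcases hs0.eq_or_lt with hs1 | hs1
    · have := q_step 0
      rw [← hs1, zero_mul] at this
      rw [pow_eq_zero_iff two_ne_zero |>.mp (le_antisymm this (sq_nonneg _)), ← hs1, mul_zero]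
    by_contra! hlt
    set r : ℝ := q 0 / s with hr
    have hr1 : ‖star a * a‖ < r := by rwa [hr, lt_div_iff₀ hs1]
    have hr0 : 0 < r := lt_of_le_of_lt (norm_nonneg _) hr1
    have iter : ∀ n, r ^ (2 ^ n) ≤ q n / s := by
      intro n
      induction n with
      | zero => simp [hr]
      | succ n ih =>
        calc r ^ (2 ^ (n + 1)) = (r ^ (2 ^ n)) ^ 2 := by rw [← pow_mul]; congr 1
          _ ≤ (q n / s) ^ 2 := by gcongr
          _ = q n ^ 2 / s ^ 2 := by rw [div_pow]
          _ ≤ (s * q (n + 1)) / s ^ 2 := by gcongr; exact q_step n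
          _ = q (n + 1) / s := by field_simp
    have hlim : Filter.Tendsto (fun n : ℕ => c / s * (‖star a * a‖ / r) ^ (2 ^ n)) Filter.atTop
        (nhds 0) := by
      have h5 : Filter.Tendsto (fun n : ℕ => (‖star a * a‖ / r) ^ n) Filter.atTop (nhds 0) :=
        tendsto_pow_atTop_nhds_zero_of_lt_one (by positivity) ((div_lt_one hr0).mpr hr1)
      have h6 : Filter.Tendsto (fun n : ℕ => 2 ^ n) Filter.atTop Filter.atTop :=
        tendsto_pow_atTop_atTop_of_one_lt one_lt_two
      simpa using (h5.comp h6).const_mul (c / s)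
    have hge : ∀ n : ℕ, 1 ≤ c / s * (‖star a * a‖ / r) ^ (2 ^ n) := by
      intro n
      have h7 := (iter n).trans (div_le_div_of_nonneg_right (q_le n) hs1.le)
      rw [div_pow, ← mul_div_assoc, le_div_iff₀ (by positivity), one_mul]
      calc _ ≤ _ := h7
        _ = _ := by ring
    exact absurd (ge_of_tendsto' hlim hge) (by norm_num)
  rw [← sq_le_sq₀ (norm_nonneg _) (by positivity), mul_pow, Real.sq_sqrt (norm_nonneg _),
    ← q_zero, preGNS_norm_sq]
  exact key

/-- Left translation by `a`, as a bounded operator for the semi-inner product of `φ`. -/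
def leftMul (hφ : IsPositive φ) (hc : IsWeaklyContinuousOnSA φ) (a : A) :
    PreGNS hφ →L[ℂ] PreGNS hφ :=
  ((toPreGNS hφ).toLinearMap ∘ₗ LinearMap.mulLeft ℂ a ∘ₗ (toPreGNS hφ).symm.toLinearMap).mkContinuous
    (Real.sqrt ‖star a * a‖) fun x => preGNS_norm_mul_le hφ hc a ((toPreGNS hφ).symm x)

theorem leftMul_apply (hφ : IsPositive φ) (hc : IsWeaklyContinuousOnSA φ) (a b : A) :
    leftMul hφ hc a (toPreGNS hφ b) = toPreGNS hφ (a * b) := rfl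

theorem leftMul_add (hφ : IsPositive φ) (hc : IsWeaklyContinuousOnSA φ) (a b : A)
    (x : PreGNS hφ) : leftMul hφ hc (a + b) x = leftMul hφ hc a x + leftMul hφ hc b x :=
  add_mul a b ((toPreGNS hφ).symm x)

theorem leftMul_smul (hφ : IsPositive φ) (hc : IsWeaklyContinuousOnSA φ) (m : ℂ) (a : A)
    (x : PreGNS hφ) : leftMul hφ hc (m • a) x = m • leftMul hφ hc a x :=
  smul_mul_assoc m a ((toPreGNS hφ).symm x)

theorem leftMul_mul (hφ : IsPositive φ) (hc : IsWeaklyContinuousOnSA φ) (a b : A)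
    (x : PreGNS hφ) : leftMul hφ hc (a * b) x = leftMul hφ hc a (leftMul hφ hc b x) :=
  mul_assoc a b ((toPreGNS hφ).symm x)

theorem leftMul_inner (hφ : IsPositive φ) (hc : IsWeaklyContinuousOnSA φ) (a : A)
    (x y : PreGNS hφ) : inner ℂ (leftMul hφ hc (star a) x) y = inner ℂ x (leftMul hφ hc a y) := by
  change φ (star (star a * (toPreGNS hφ).symm x) * (toPreGNS hφ).symm y) =
    φ (star ((toPreGNS hφ).symm x) * (a * (toPreGNS hφ).symm y))
  rw [star_mul, star_star, mul_assoc]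

theorem leftMul_completion_smul (hφ : IsPositive φ) (hc : IsWeaklyContinuousOnSA φ) (m : ℂ)
    (a : A) : (leftMul hφ hc (m • a)).completion = m • (leftMul hφ hc a).completion := by
  ext c
  induction c using UniformSpace.Completion.induction_on with
  | hp =>
    exact isClosed_eq (leftMul hφ hc (m • a)).completion.continuous
      (m • (leftMul hφ hc a).completion).continuous
  | ih c => simp [leftMul_smul]

/-- The GNS representation `π_φ` of `A` in `H_φ`, for a positive linear functional `φ` that is
weakly continuous on `A_sa`: `π_φ(a)` is the continuous extension of left translation by `a`. -/
def gnsRep (hφ : IsPositive φ) (hc : IsWeaklyContinuousOnSA φ) :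
    A →⋆ₙₐ[ℂ] (GNSSpace hφ →L[ℂ] GNSSpace hφ) where
  toFun a := (leftMul hφ hc a).completion
  map_smul' := leftMul_completion_smul hφ hc
  map_zero' := by simpa using leftMul_completion_smul hφ hc 0 0
  map_add' a b := by
    ext c
    induction c using UniformSpace.Completion.induction_on with
    | hp => apply isClosed_eq <;> fun_prop
    | ih c => simp [leftMul_add, UniformSpace.Completion.coe_add]
  map_mul' a b := by
    ext c
    induction c using UniformSpace.Completion.induction_on with
    | hp => apply isClosed_eq <;> fun_prop
    | ih c => simp [leftMul_mul]
  map_star' a := by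
    refine (ContinuousLinearMap.eq_adjoint_iff (leftMul hφ hc (star a)).completion
      (leftMul hφ hc a).completion).mpr ?_
    intro x y
    induction x, y using UniformSpace.Completion.induction_on₂ with
    | hp => apply isClosed_eq <;> fun_prop
    | ih x y => simp [leftMul_inner]

/-- The GNS representation `π_ψ` of a state `ψ`. -/
def IsState.gns {ψ : A →ₗ[ℂ] ℂ} (hψ : IsState ψ) :
    A →⋆ₙₐ[ℂ] (GNSSpace hψ.positive →L[ℂ] GNSSpace hψ.positive) :=
  gnsRep hψ.positive hψ.weaklyContinuous

end GNS

end NormedStarAlg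

end

open scoped ComplexOrder

noncomputable section

namespace NormedStarAlg

/-! ### Representations: Schur's lemma, invariant subspaces, cyclic vectors -/

section Representations

variable {A : Type*} [NonUnitalNormedRing A] [NormedSpace ℂ A] [StarRing A]
  {H : Type*} [NormedAddCommGroup H] [InnerProductSpace ℂ H] [CompleteSpace H]
  {K : Type*} [NormedAddCommGroup K] [InnerProductSpace ℂ K] [CompleteSpace K]

/-! Everything is reduced to a representation `π` with a cyclic unit vector `c`, where `π` is
norm-contractive on `A_sa`. For a state, finite variation and Riesz give a vector `c` of the GNS
space with `ψ(a) = ⟪c, [a]⟫`; then `π(a)c = [a]`, so `c` is cyclic and replaces the missing unit,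
and `‖c‖² = v(ψ) = 1` (`IsState.exists_cyclic`).

For such a pair the three conditions are proved in a cycle (`tfae_vectorFunctional`). If `π` is
irreducible, a subordinate functional comes from a self-adjoint operator `T` commuting with `π`
(Radon–Nikodym), and `T` is scalar by Schur. If `ψ` is indecomposable, each summand of a convex
decomposition is subordinate to `ψ`, hence proportional, hence equal after comparing variations. If
`ψ` is pure, the projection onto a closed invariant subspace splits `ψ` into two multiples of
states, and purity makes the projection scalar.

σ-contractivity amounts to `‖π(a)‖ ≤ ‖a‖` on `A_sa`, by the C*-identity and powers of `a* a`.
Conversely, every unit vector of an irreducible σ-contractive representation is cyclic and gives a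
pure state, and a cyclic representation is determined up to unitary equivalence by its vector
functional. -/

/-- The linear map `a ↦ π(a) x`. -/
def orbitMap (π : A →⋆ₙₐ[ℂ] (H →L[ℂ] H)) (x : H) : A →ₗ[ℂ] H where
  toFun a := π a x
  map_add' a b := by simp
  map_smul' m a := by simp

/-- The functional `a ↦ ⟪x, π(a) x⟫`. -/
def vectorFunctional (π : A →⋆ₙₐ[ℂ] (H →L[ℂ] H)) (x : H) : A →ₗ[ℂ] ℂ where
  toFun a := inner ℂ x (π a x)
  map_add' a b := by simp
  map_smul' m a := by simp

set_option linter.unusedSectionVars false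

variable {π : A →⋆ₙₐ[ℂ] (H →L[ℂ] H)}

theorem orbitMap_apply (π : A →⋆ₙₐ[ℂ] (H →L[ℂ] H)) (x : H) (a : A) :
    orbitMap π x a = π a x := rfl

theorem vectorFunctional_apply (π : A →⋆ₙₐ[ℂ] (H →L[ℂ] H)) (x : H) (a : A) :
    vectorFunctional π x a = inner ℂ x (π a x) := rfl

theorem inner_rep_star_left (π : A →⋆ₙₐ[ℂ] (H →L[ℂ] H)) (a : A) (x y : H) :
    inner ℂ (π (star a) x) y = inner ℂ x (π a y) := by
  rw [map_star, ContinuousLinearMap.star_eq_adjoint, ContinuousLinearMap.adjoint_inner_left]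

theorem inner_rep_rep (π : A →⋆ₙₐ[ℂ] (H →L[ℂ] H)) (a b : A) (x y : H) :
    inner ℂ (π a x) (π b y) = inner ℂ x (π (star a * b) y) := by
  rw [map_mul, mul_apply_eq_comp, ← inner_rep_star_left π (star a), star_star]

theorem vectorFunctional_star_mul_self (π : A →⋆ₙₐ[ℂ] (H →L[ℂ] H)) (x : H) (a : A) :
    vectorFunctional π x (star a * a) = ((‖π a x‖ ^ 2 : ℝ) : ℂ) := by
  rw [vectorFunctional_apply, ← inner_rep_rep, inner_self_eq_norm_sq_to_K]
  norm_cast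

/-- A Schur lemma: a self-adjoint operator that commutes with an irreducible representation is a
scalar. -/
theorem IsIrreducible.exists_eq_smul (hπ : IsIrreducible π) {T : H →L[ℂ] H}
    (hT : IsSelfAdjoint T) (hcomm : ∀ a, Commute T (π a)) : ∃ z : ℂ, T = z • 1 := by
  have hsub : ∀ p ∈ spectrum ℝ T, ∀ q ∈ spectrum ℝ T, ¬ p < q := by
    intro p hp q hq hpq
    -- The positive and negative parts about the midpoint of `p` and `q`: `f * g = 0`, while `g p >
    -- 0` and `f q > 0`. The kernel of `f(T)` is closed and invariant, so it is `0` or `H`; these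
    -- force `g(T) = 0` and `f(T) = 0` respectively, and either is absurd on the spectrum.
    set f : ℝ → ℝ := fun s => max (s - (p + q) / 2) 0 with hf
    set g : ℝ → ℝ := fun s => max ((p + q) / 2 - s) 0 with hg
    have hfc : Continuous f := by fun_prop
    have hgc : Continuous g := by fun_prop
    have hfg : cfc f T * cfc g T = 0 := by
      rw [← cfc_mul f g T hfc.continuousOn hgc.continuousOn]
      convert cfc_const_zero ℝ T using 2
      ext s
      rcases le_total s ((p + q) / 2) with h | h
      · simp [hf, max_eq_right (sub_nonpos.mpr h)]
      · simp [hg, max_eq_right (sub_nonpos.mpr h)]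
    have hinv : ∀ a : A, ∀ x ∈ (cfc f T).ker, π a x ∈ (cfc f T).ker := by
      intro a x hx
      have h1 := congrArg (· x) ((hcomm a).cfc_real f).eq
      simp only [mul_apply_eq_comp] at h1
      rw [LinearMap.mem_ker] at hx ⊢
      have hx' : (cfc f T) x = 0 := hx
      change (cfc f T) (π a x) = 0
      rw [h1, hx', map_zero]
    have hne : ∀ (k : ℝ → ℝ), Continuous k → ∀ s ∈ spectrum ℝ T, cfc k T = 0 → k s = 0 := by
      intro k hk s hs h0
      have := eqOn_of_cfc_eq_cfc (f := k) (g := fun _ => (0 : ℝ)) (a := T)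
        (by rw [h0, cfc_const_zero]) hk.continuousOn continuousOn_const hT
      exact this hs
    rcases hπ.2 (cfc f T).ker (cfc f T).isClosed_ker hinv with h | h
    · have hg0 : cfc g T = 0 := by
        ext x
        have : (cfc g T) x ∈ (cfc f T).ker := by
          change (cfc f T) ((cfc g T) x) = 0
          rw [← mul_apply_eq_comp, hfg, zero_apply]
        rw [h, Submodule.mem_bot] at this
        simpa using this
      have := hne g hgc p hp hg0
      simp only [hg] at this
      have h2 := le_max_left ((p + q) / 2 - p) 0
      linarith
    · have hf0 : cfc f T = 0 := by
        ext x
        have : x ∈ (cfc f T).ker := h ▸ Submodule.mem_top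
        simpa using this
      have := hne f hfc q hq hf0
      simp only [hf] at this
      have h2 := le_max_left (q - (p + q) / 2) 0
      linarith
  have hconst : ∃ r : ℝ, ∀ s ∈ spectrum ℝ T, s = r := by
    rcases (spectrum ℝ T).eq_empty_or_nonempty with h | ⟨r, hr⟩
    · exact ⟨0, by simp [h]⟩
    · exact ⟨r, fun s hs => le_antisymm (not_lt.mp (hsub r hr s hs))
        (not_lt.mp (hsub s hs r hr))⟩
  obtain ⟨r, hr⟩ := hconst
  refine ⟨r, ?_⟩
  calc T = cfc (id : ℝ → ℝ) T := (cfc_id ℝ T hT).symm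
    _ = cfc (fun _ : ℝ => r) T := cfc_congr fun s hs => hr s hs
    _ = algebraMap ℝ (H →L[ℂ] H) r := cfc_const r T hT
    _ = (r : ℂ) • 1 := by
      rw [Algebra.algebraMap_eq_smul_one]
      ext x
      simp

/-- The orthogonal projection onto a closed invariant subspace commutes with the representation. -/
theorem starProjection_rep (M : Submodule ℂ H) [M.HasOrthogonalProjection]
    (hM : ∀ a : A, ∀ x ∈ M, π a x ∈ M) (a : A) (x : H) :
    M.starProjection (π a x) = π a (M.starProjection x) := by
  refine Submodule.eq_starProjection_of_mem_orthogonal (hM a _ (M.starProjection_apply_mem x)) ?_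
  rw [← map_sub, Submodule.mem_orthogonal]
  intro u hu
  rw [← inner_rep_star_left]
  exact Submodule.inner_right_of_mem_orthogonal (hM _ u hu)
    (M.sub_starProjection_mem_orthogonal x)

theorem eq_bot_or_eq_top_of_starProjection_eq_smul (M : Submodule ℂ H)
    [M.HasOrthogonalProjection] (z : ℂ) (h : ∀ x, M.starProjection x = z • x) :
    M = ⊥ ∨ M = ⊤ := by
  rcases eq_or_ne z 0 with rfl | hz
  · left
    rw [Submodule.eq_bot_iff]
    intro x hx
    rw [← Submodule.starProjection_eq_self_iff.mpr hx, h, zero_smul]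
  · right
    rw [Submodule.eq_top_iff']
    intro x
    have := M.smul_mem z⁻¹ (M.starProjection_apply_mem x)
    rwa [h, inv_smul_smul₀ hz] at this

/-- A representation with a cyclic vector separates vectors from `0`. -/
theorem eq_zero_of_rep_eq_zero {c : H} (hc : DenseRange (orbitMap π c)) {x : H}
    (h : ∀ a, π a x = 0) : x = 0 := by
  refine Dense.eq_of_inner_left ℂ hc ?_
  rintro _ ⟨a, rfl⟩
  rw [orbitMap_apply, ← inner_rep_star_left, h, inner_zero_left, inner_zero_left]

/-- Every non-zero vector is cyclic for an irreducible representation. -/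
theorem IsIrreducible.denseRange_orbitMap (hπ : IsIrreducible π) {x : H} (hx : x ≠ 0) :
    DenseRange (orbitMap π x) := by
  have key := hπ.2 (LinearMap.range (orbitMap π x)).topologicalClosure
    (Submodule.isClosed_topologicalClosure _) ?_
  · rcases key with h | h
    · exfalso
      have hzero : ∀ a, π a x = 0 := by
        intro a
        have : orbitMap π x a ∈ (LinearMap.range (orbitMap π x)).topologicalClosure :=
          Submodule.le_topologicalClosure _ ⟨a, rfl⟩
        rwa [h, Submodule.mem_bot] at this
      -- If all `π(a)` kill `x`, the line through `x` is invariant, so it is all of `H` and `π = 0`.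
      have hspan := hπ.2 (ℂ ∙ x) (Submodule.closed_of_finiteDimensional _) ?_
      · rcases hspan with h1 | h1
        · exact hx (Submodule.span_singleton_eq_bot.mp h1)
        · obtain ⟨a, ha⟩ := hπ.1
          apply ha
          ext y
          obtain ⟨m, rfl⟩ := Submodule.mem_span_singleton.mp
            (h1 ▸ Submodule.mem_top : y ∈ (ℂ ∙ x))
          simp [hzero]
      · intro a y hy
        obtain ⟨m, rfl⟩ := Submodule.mem_span_singleton.mp hy
        simp [hzero]
    · have := Submodule.dense_iff_topologicalClosure_eq_top.mpr h
      exact this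
  · intro a y hy
    have hmaps : Set.MapsTo (π a) (LinearMap.range (orbitMap π x))
        (LinearMap.range (orbitMap π x)) := by
      rintro _ ⟨b, rfl⟩
      exact ⟨a * b, by simp [orbitMap_apply]⟩
    exact hmaps.closure (π a).continuous hy

/-- Two cyclic representations with the same vector functional are spatially equivalent. -/
theorem spatiallyEquivalent_of_vectorFunctional_eq {ρ : A →⋆ₙₐ[ℂ] (K →L[ℂ] K)} {x : H} {y : K}
    (hx : DenseRange (orbitMap π x)) (hy : DenseRange (orbitMap ρ y))
    (h : vectorFunctional π x = vectorFunctional ρ y) : SpatiallyEquivalent π ρ := by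
  have hnorm : ∀ a, ‖orbitMap ρ y (LinearEquiv.refl ℂ A a)‖ = ‖orbitMap π x a‖ := by
    intro a
    have h1 := vectorFunctional_star_mul_self π x a
    rw [h, vectorFunctional_star_mul_self, Complex.ofReal_inj] at h1
    exact (sq_eq_sq₀ (norm_nonneg _) (norm_nonneg _)).mp h1
  -- The unitary extends `π(a)x ↦ ρ(a)y`, isometric because the functionals agree at `a* a`.
  refine ⟨(LinearEquiv.refl ℂ A).extendOfIsometry _ _ hx hy hnorm, fun a v => ?_⟩
  induction v using hx.induction_on with
  | hp => apply isClosed_eq <;> fun_prop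
  | ih b =>
    have hπ : π a (orbitMap π x b) = orbitMap π x (a * b) := by simp [orbitMap_apply]
    rw [hπ, LinearEquiv.extendOfIsometry_eq, LinearEquiv.extendOfIsometry_eq]
    simp [orbitMap_apply]

end Representations

section States

set_option linter.unusedSectionVars false

variable {A : Type*} [NonUnitalNormedRing A] [NormedSpace ℂ A] [IsScalarTower ℂ A A]
  [SMulCommClass ℂ A A] [StarRing A] [StarModule ℂ A]
  {H : Type*} [NormedAddCommGroup H] [InnerProductSpace ℂ H] [CompleteSpace H]
  {π : A →⋆ₙₐ[ℂ] (H →L[ℂ] H)} {φ ψ : A →ₗ[ℂ] ℂ}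

/-! ### Vector functionals -/

theorem isPositive_vectorFunctional (π : A →⋆ₙₐ[ℂ] (H →L[ℂ] H)) (x : H) :
    IsPositive (vectorFunctional π x) := by
  intro a
  rw [vectorFunctional_star_mul_self, Complex.zero_le_real]
  positivity

theorem isHermitian_vectorFunctional (π : A →⋆ₙₐ[ℂ] (H →L[ℂ] H)) (x : H) :
    IsHermitian (vectorFunctional π x) := by
  intro a
  rw [vectorFunctional_apply, vectorFunctional_apply, ← inner_rep_star_left, star_star]
  exact (inner_conj_symm _ _).symm

theorem norm_sq_mem_variationBounds (π : A →⋆ₙₐ[ℂ] (H →L[ℂ] H)) (x : H) :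
    ‖x‖ ^ 2 ∈ variationBounds (vectorFunctional π x) := by
  refine ⟨by positivity, fun a => ?_⟩
  rw [vectorFunctional_star_mul_self, Complex.ofReal_re, ← mul_pow, vectorFunctional_apply]
  gcongr
  exact norm_inner_le_norm _ _

/-- Since `φ(b* a b) = ⟪π(b)x, π(a)π(b)x⟫`, a norm bound on self-adjoint elements suffices; the map
is even Lipschitz there. -/
theorem isWeaklyContinuousOnSA_vectorFunctional (hπ : ∀ a, IsSelfAdjoint a → ‖π a‖ ≤ ‖a‖)
    (x : H) : IsWeaklyContinuousOnSA (vectorFunctional π x) := by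
  intro b
  have hlip : LipschitzOnWith (‖π b x‖₊ ^ 2)
      (fun a : A => vectorFunctional π x (star b * a * b)) {a : A | IsSelfAdjoint a} := by
    refine LipschitzOnWith.of_dist_le_mul fun a ha a' ha' => ?_
    have h1 : ∀ a : A, vectorFunctional π x (star b * a * b) =
        inner ℂ (π b x) (π a (π b x)) := fun a => by
      rw [vectorFunctional_apply, mul_assoc, ← inner_rep_rep, map_mul, mul_apply_eq_comp]
    rw [h1, h1, dist_eq_norm, dist_eq_norm, ← inner_sub_right, ← sub_apply, ← map_sub]
    have h2 := hπ _ (IsSelfAdjoint.sub ha ha')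
    calc _ ≤ ‖π b x‖ * (‖π (a - a')‖ * ‖π b x‖) := (norm_inner_le_norm _ _).trans
          (mul_le_mul_of_nonneg_left ((π (a - a')).le_opNorm _) (norm_nonneg _))
      _ ≤ ‖π b x‖ * (‖a - a'‖ * ‖π b x‖) := by gcongr
      _ = _ := by push_cast; ring
  exact hlip.continuousOn

theorem bddBelow_variationBounds (φ : A →ₗ[ℂ] ℂ) : BddBelow (variationBounds φ) :=
  ⟨0, fun _ hv => hv.1⟩

/-- Cauchy–Schwarz gives `≤`. For `≥`, the inequality defining a bound `v` extends from the orbit to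
its closure and is tested at `x` itself. Only membership of `x` in its own orbit closure is
required, so that projections of a cyclic vector are covered. -/
theorem variation_vectorFunctional {x : H} (hx : x ∈ closure (Set.range (orbitMap π x))) :
    variation (vectorFunctional π x) = ‖x‖ ^ 2 := by
  refine le_antisymm (csInf_le (bddBelow_variationBounds _) (norm_sq_mem_variationBounds π x))
    (le_csInf ⟨_, norm_sq_mem_variationBounds π x⟩ fun v hv => ?_)
  have key : ‖(inner ℂ x x : ℂ)‖ ^ 2 ≤ v * ‖x‖ ^ 2 := by
    refine closure_minimal (s := Set.range (orbitMap π x))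
      (t := {y : H | ‖(inner ℂ x y : ℂ)‖ ^ 2 ≤ v * ‖y‖ ^ 2}) ?_
      (isClosed_le (by fun_prop) (by fun_prop)) hx
    rintro _ ⟨a, rfl⟩
    have := hv.2 a
    rwa [vectorFunctional_star_mul_self, Complex.ofReal_re] at this
  rw [inner_self_eq_norm_sq_to_K] at key
  rcases eq_or_ne x 0 with rfl | hx0
  · simpa using hv.1
  have hpos : 0 < ‖x‖ ^ 2 := by positivity
  have h3 : ‖((‖x‖ : ℂ) ^ 2)‖ = ‖x‖ ^ 2 := by simp
  refine le_of_mul_le_mul_right ?_ hpos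
  calc ‖x‖ ^ 2 * ‖x‖ ^ 2 = ‖((‖x‖ : ℂ) ^ 2)‖ ^ 2 := by rw [h3]; ring
    _ ≤ _ := key

theorem isState_vectorFunctional (hπ : ∀ a, IsSelfAdjoint a → ‖π a‖ ≤ ‖a‖) {x : H}
    (hx : x ∈ closure (Set.range (orbitMap π x))) (hx1 : ‖x‖ = 1) :
    IsState (vectorFunctional π x) where
  positive := isPositive_vectorFunctional π x
  weaklyContinuous := isWeaklyContinuousOnSA_vectorFunctional hπ x
  finiteVariation := ⟨_, norm_sq_mem_variationBounds π x⟩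
  variation_eq_one := by rw [variation_vectorFunctional hx, hx1, one_pow]

/-! ### Scaling of functionals and their variation -/

/-- The defining inequalities are closed in `v`, so the infimum is attained. -/
theorem variation_mem_variationBounds (h : HasFiniteVariation φ) (hφ : IsPositive φ) :
    variation φ ∈ variationBounds φ := by
  refine ⟨le_csInf h fun v hv => hv.1, fun a => ?_⟩
  have h0 : 0 ≤ (φ (star a * a)).re := (Complex.le_def.mp (hφ a)).1
  have hcl : variation φ ∈ closure (variationBounds φ) :=
    csInf_mem_closure h (bddBelow_variationBounds φ)
  exact closure_minimal (t := {v : ℝ | ‖φ a‖ ^ 2 ≤ v * (φ (star a * a)).re})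
    (fun v hv => hv.2 a) (isClosed_le (by fun_prop) (by fun_prop)) hcl

theorem mem_variationBounds_smul {v r : ℝ} (hv : v ∈ variationBounds φ) (hr : 0 ≤ r) :
    r * v ∈ variationBounds ((r : ℂ) • φ) := by
  refine ⟨mul_nonneg hr hv.1, fun a => ?_⟩
  simp only [LinearMap.smul_apply, smul_eq_mul, norm_mul, Complex.norm_real,
    Complex.re_ofReal_mul, mul_pow, Real.norm_of_nonneg hr]
  nlinarith [mul_le_mul_of_nonneg_left (hv.2 a) (sq_nonneg r)]

theorem IsPositive.smul (hφ : IsPositive φ) {r : ℝ} (hr : 0 ≤ r) :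
    IsPositive ((r : ℂ) • φ) := fun a => by
  simpa using mul_nonneg (Complex.zero_le_real.mpr hr) (hφ a)

theorem IsHermitian.smul (hφ : IsHermitian φ) (r : ℝ) : IsHermitian ((r : ℂ) • φ) := fun a => by
  simp [hφ a]

theorem IsState.ne_zero (hψ : IsState ψ) : ψ ≠ 0 := by
  rintro rfl
  have h : (0 : ℝ) ∈ variationBounds (0 : A →ₗ[ℂ] ℂ) := ⟨le_rfl, fun a => by simp⟩
  have := csInf_le (bddBelow_variationBounds _) h
  have h1 := hψ.variation_eq_one
  unfold variation at h1
  linarith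

theorem IsState.exists_pos (hψ : IsState ψ) : ∃ a, 0 < ψ (star a * a) := by
  by_contra! h
  apply hψ.ne_zero
  obtain ⟨v, hv⟩ := hψ.finiteVariation
  ext a
  have h0 : ψ (star a * a) = 0 := by
    by_contra hne
    exact h a (lt_of_le_of_ne (hψ.positive a) (Ne.symm hne))
  have := hv.2 a
  rw [h0, Complex.zero_re, mul_zero] at this
  simpa using le_antisymm this (sq_nonneg _)

theorem IsState.one_le_of_smul {r : ℝ} (hψ : IsState ψ) (hr : 0 ≤ r)
    (h : IsState ((r : ℂ) • ψ)) : 1 ≤ r := by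
  have h1 := variation_mem_variationBounds hψ.finiteVariation hψ.positive
  have h2 := csInf_le (bddBelow_variationBounds _) (mem_variationBounds_smul h1 hr)
  rw [hψ.variation_eq_one, mul_one] at h2
  exact h.variation_eq_one ▸ h2

/-- Proportional states are equal. -/
theorem IsState.eq_of_eq_smul (hψ : IsState ψ) (hφ : IsState φ) {z : ℂ} (h : φ = z • ψ) :
    φ = ψ := by
  obtain ⟨a, ha⟩ := hψ.exists_pos
  have h1 := hφ.positive a
  rw [h, LinearMap.smul_apply, smul_eq_mul] at h1
  have hz : 0 ≤ z := by
    have h2 := mul_nonneg h1 (inv_nonneg.mpr ha.le)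
    rwa [mul_inv_cancel_right₀ ha.ne'] at h2
  obtain ⟨r, hr, rfl⟩ : ∃ r : ℝ, 0 ≤ r ∧ (r : ℂ) = z :=
    ⟨z.re, (Complex.le_def.mp hz).1, Complex.ext rfl (Complex.le_def.mp hz).2⟩
  have h2 : 1 ≤ r := hψ.one_le_of_smul hr (h ▸ hφ)
  have h3 : ψ = ((r⁻¹ : ℝ) : ℂ) • φ := by
    rw [h, smul_smul, ← Complex.ofReal_mul, inv_mul_cancel₀ (by positivity), Complex.ofReal_one,
      one_smul]
  have h4 : 1 ≤ r⁻¹ := hφ.one_le_of_smul (inv_nonneg.mpr hr) (h3 ▸ hψ)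
  have h5 : r = 1 := le_antisymm ((one_le_inv₀ (by positivity)).mp h4) h2
  rw [h, h5, Complex.ofReal_one, one_smul]

/-! ### The GNS representation of a state -/

theorem IsState.gns_apply_coe (hψ : IsState ψ) (a b : A) :
    hψ.gns a (toPreGNS hψ.positive b : GNSSpace hψ.positive) =
      (toPreGNS hψ.positive (a * b) : GNSSpace hψ.positive) := by
  change (leftMul hψ.positive hψ.weaklyContinuous a).completion _ = _
  rw [ContinuousLinearMap.completion_apply_coe, leftMul_apply]

theorem IsState.norm_gns_le (hψ : IsState ψ) (a : A) : ‖hψ.gns a‖ ≤ Real.sqrt ‖star a * a‖ := by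
  refine ContinuousLinearMap.opNorm_le_bound _ (Real.sqrt_nonneg _) fun x => ?_
  induction x using UniformSpace.Completion.induction_on with
  | hp => apply isClosed_le <;> fun_prop
  | ih x =>
    obtain ⟨b, rfl⟩ := (toPreGNS hψ.positive).surjective x
    rw [hψ.gns_apply_coe, UniformSpace.Completion.norm_coe, UniformSpace.Completion.norm_coe]
    exact preGNS_norm_mul_le _ hψ.weaklyContinuous a b

theorem IsState.norm_gns_le_of_isSelfAdjoint (hψ : IsState ψ) (a : A) (ha : IsSelfAdjoint a) :
    ‖hψ.gns a‖ ≤ ‖a‖ := by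
  refine (hψ.norm_gns_le a).trans (Real.sqrt_le_iff.mpr ⟨norm_nonneg _, ?_⟩)
  rw [ha.star_eq, sq]
  exact norm_mul_le a a

/-- The canonical map of `A` into the space of the GNS representation. -/
def toGNS (hφ : IsPositive φ) : A →ₗ[ℂ] GNSSpace hφ :=
  (UniformSpace.Completion.toComplL : PreGNS hφ →L[ℂ] GNSSpace hφ).toLinearMap ∘ₗ
    (toPreGNS hφ).toLinearMap

theorem toGNS_apply (hφ : IsPositive φ) (a : A) :
    toGNS hφ a = (toPreGNS hφ a : GNSSpace hφ) := rfl

theorem denseRange_toGNS (hφ : IsPositive φ) : DenseRange (toGNS hφ) :=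
  UniformSpace.Completion.denseRange_coe.comp (toPreGNS hφ).surjective.denseRange
    (UniformSpace.Completion.continuous_coe _)

theorem norm_toGNS_sq (hφ : IsPositive φ) (a : A) :
    ‖toGNS hφ a‖ ^ 2 = (φ (star a * a)).re := by
  rw [toGNS_apply, UniformSpace.Completion.norm_coe, preGNS_norm_sq]

theorem inner_toGNS (hφ : IsPositive φ) (a b : A) :
    inner ℂ (toGNS hφ a) (toGNS hφ b) = φ (star a * b) := by
  rw [toGNS_apply, toGNS_apply, UniformSpace.Completion.inner_coe, preGNS_inner]

/-- A functional bounded along a map with dense range into a Hilbert space is given by a vector. -/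
theorem exists_inner_eq {e : A →ₗ[ℂ] H} (he : DenseRange e) {C : ℝ} (hC : 0 ≤ C)
    (h : ∀ a, ‖φ a‖ ^ 2 ≤ C * ‖e a‖ ^ 2) : ∃ d : H, ∀ a, φ a = inner ℂ d (e a) := by
  refine ⟨(InnerProductSpace.toDual ℂ H).symm (φ.extendOfNorm e), fun a => ?_⟩
  rw [InnerProductSpace.toDual_symm_apply, LinearMap.extendOfNorm_eq he]
  refine ⟨Real.sqrt C, fun a => ?_⟩
  rw [← sq_le_sq₀ (norm_nonneg _) (by positivity), mul_pow, Real.sq_sqrt hC]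
  exact h a

/-- Every state is a vector functional of its GNS representation at a cyclic unit vector. -/
theorem IsState.exists_cyclic (hψ : IsState ψ) :
    ∃ c : GNSSpace hψ.positive, DenseRange (orbitMap hψ.gns c) ∧ ‖c‖ = 1 ∧
      ψ = vectorFunctional hψ.gns c := by
  obtain ⟨v, hv⟩ := hψ.finiteVariation
  obtain ⟨c, hc⟩ := exists_inner_eq (φ := ψ) (denseRange_toGNS hψ.positive) hv.1 fun a => by
    rw [norm_toGNS_sq]
    exact hv.2 a
  have hmul : ∀ a b, hψ.gns a (toGNS hψ.positive b) = toGNS hψ.positive (a * b) :=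
    fun a b => hψ.gns_apply_coe a b
  -- The vector `c` acts as the class of a unit: `⟪π(a)c, [b]⟫ = ⟪c, [a* b]⟫ = ψ(a* b) = ⟪[a],
  -- [b]⟫`.
  have horb : orbitMap hψ.gns c = toGNS hψ.positive := by
    ext a
    refine Dense.eq_of_inner_left ℂ (denseRange_toGNS hψ.positive) ?_
    rintro _ ⟨b, rfl⟩
    rw [orbitMap_apply, inner_toGNS, hc, ← hmul, ← inner_rep_star_left, star_star]
  have hdense : DenseRange (orbitMap hψ.gns c) := horb ▸ denseRange_toGNS hψ.positive
  have hvec : ψ = vectorFunctional hψ.gns c := by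
    ext a
    rw [vectorFunctional_apply, ← orbitMap_apply, horb, hc]
  refine ⟨c, hdense, ?_, hvec⟩
  have h1 := variation_vectorFunctional (hdense.closure_range ▸ Set.mem_univ c)
  rw [← hvec, hψ.variation_eq_one] at h1
  exact (pow_eq_one_iff_of_nonneg (norm_nonneg c) two_ne_zero).mp h1.symm

/-- Without a unit, positivity alone does not give this; finite variation enters through the cyclic
vector. -/
theorem IsState.isHermitian (hψ : IsState ψ) : IsHermitian ψ := by
  obtain ⟨c, -, -, h⟩ := hψ.exists_cyclic
  rw [h]
  exact isHermitian_vectorFunctional _ _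

/-! ### Irreducibility, indecomposability and purity -/

theorem IsPositive.norm_sq_le (hφ : IsPositive φ) (a b : A) :
    ‖φ (star a * b)‖ ^ 2 ≤ (φ (star a * a)).re * (φ (star b * b)).re := by
  rw [← norm_toGNS_sq hφ, ← norm_toGNS_sq hφ, ← inner_toGNS hφ, ← mul_pow]
  gcongr
  exact norm_inner_le_norm _ _

/-- A Radon–Nikodym argument: a subordinate `φ` has the form `φ(a* b) = ⟪T π(a)c, π(b)c⟫` with `T`
self-adjoint and commuting with `π`, so Schur's lemma applies. -/
theorem IsIrreducible.isIndecomposable (hπ : IsIrreducible π) {c : H}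
    (hc : DenseRange (orbitMap π c)) : IsIndecomposable (vectorFunctional π c) where
  positive := isPositive_vectorFunctional π c
  hermitian := isHermitian_vectorFunctional π c
  finiteVariation := ⟨_, norm_sq_mem_variationBounds π c⟩
  eq_smul φ hφ _ hfin hsub := by
    obtain ⟨v, hv⟩ := hfin
    obtain ⟨r, hr, hrφ⟩ := hsub
    have hle : ∀ a, (φ (star a * a)).re ≤ r * ‖orbitMap π c a‖ ^ 2 := by
      intro a
      have h1 := (Complex.le_def.mp (hrφ a)).1
      rw [LinearMap.sub_apply, LinearMap.smul_apply, vectorFunctional_star_mul_self] at h1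
      simp only [smul_eq_mul, Complex.zero_re, Complex.sub_re, ← Complex.ofReal_mul,
        Complex.ofReal_re] at h1
      rw [orbitMap_apply]
      linarith
    have hnn : ∀ a, 0 ≤ (φ (star a * a)).re := fun a => (Complex.le_def.mp (hφ a)).1
    -- Finite variation then subordination: `|φ(a)|² ≤ v φ(a* a) ≤ v r ‖π(a)c‖²`.
    obtain ⟨d, hd⟩ := exists_inner_eq (φ := φ) hc (mul_nonneg hv.1 hr) fun a =>
      (hv.2 a).trans (by
        rw [mul_assoc]
        exact mul_le_mul_of_nonneg_left (hle a) hv.1)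
    have hd2 : ∀ a b, inner ℂ (orbitMap π d a) (orbitMap π c b) = φ (star a * b) := by
      intro a b
      rw [orbitMap_apply, orbitMap_apply, inner_rep_rep, hd, orbitMap_apply]
    -- Cauchy–Schwarz for `φ` bounds `⟪π(a)d, y⟫` on the dense orbit of `c`, hence everywhere;
    -- taking `y = π(a)d` shows that `π(a)c ↦ π(a)d` is bounded.
    have hbound : ∀ a, ‖orbitMap π d a‖ ≤ r * ‖orbitMap π c a‖ := by
      intro a
      have h1 : ∀ y, ‖(inner ℂ (orbitMap π d a) y : ℂ)‖ ≤ r * ‖orbitMap π c a‖ * ‖y‖ := by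
        intro y
        induction y using hc.induction_on with
        | hp => apply isClosed_le <;> fun_prop
        | ih b =>
          rw [hd2, ← sq_le_sq₀ (norm_nonneg _) (by positivity)]
          calc _ ≤ _ := hφ.norm_sq_le a b
            _ ≤ (r * ‖orbitMap π c a‖ ^ 2) * (r * ‖orbitMap π c b‖ ^ 2) :=
              mul_le_mul (hle a) (hle b) (hnn b) (by positivity)
            _ = _ := by ring
      have h2 := h1 (orbitMap π d a)
      rw [inner_self_eq_norm_sq_to_K] at h2
      rcases (norm_nonneg (orbitMap π d a)).eq_or_lt with h | h
      · rw [← h]; positivity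
      · refine le_of_mul_le_mul_right ?_ h
        simpa [sq] using h2
    set T : H →L[ℂ] H := (orbitMap π d).extendOfNorm (orbitMap π c) with hT
    have hTa : ∀ a, T (orbitMap π c a) = orbitMap π d a :=
      LinearMap.extendOfNorm_eq hc ⟨r, hbound⟩
    have hsa : IsSelfAdjoint T := by
      rw [ContinuousLinearMap.isSelfAdjoint_iff_isSymmetric]
      intro x y
      induction x using hc.induction_on with
      | hp => apply isClosed_eq <;> simp only [ContinuousLinearMap.coe_coe] <;> fun_prop
      | ih a =>
        induction y using hc.induction_on with
        | hp => apply isClosed_eq <;> simp only [ContinuousLinearMap.coe_coe] <;> fun_prop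
        | ih b =>
          simp only [ContinuousLinearMap.coe_coe]
          rw [hTa, hTa, hd2, ← inner_conj_symm, hd2]
          exact (hφ.form_symm a b).symm
    have hcomm : ∀ a, Commute T (π a) := by
      intro a
      ext x
      simp only [mul_apply_eq_comp]
      induction x using hc.induction_on with
      | hp => apply isClosed_eq <;> fun_prop
      | ih b =>
        have h1 : ∀ y, π a (orbitMap π y b) = orbitMap π y (a * b) := fun y => by
          simp [orbitMap_apply]
        rw [h1, hTa, hTa, h1]
    obtain ⟨z, hz⟩ := hπ.exists_eq_smul hsa hcomm
    have hdc : d - z • c = 0 := by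
      refine eq_zero_of_rep_eq_zero hc fun a => ?_
      have := hTa a
      rw [hz] at this
      rw [map_sub, map_smul, ← orbitMap_apply, ← orbitMap_apply, ← this]
      simp
    -- The conjugate appears because `d = z • c` sits in the conjugate-linear slot.
    refine ⟨star z, ?_⟩
    ext a
    rw [hd, sub_eq_zero.mp hdc, inner_smul_left]
    rfl

/-- If the projection of a cyclic vector to a closed invariant subspace gives a multiple of the
vector functional, the subspace is trivial. -/
theorem eq_bot_or_eq_top_of_vectorFunctional_eq_smul {c : H} (hc : DenseRange (orbitMap π c))
    (M : Submodule ℂ H) [M.HasOrthogonalProjection] (hM : ∀ a : A, ∀ x ∈ M, π a x ∈ M) {z : ℂ}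
    (h : vectorFunctional π (M.starProjection c) = z • vectorFunctional π c) :
    M = ⊥ ∨ M = ⊤ := by
  refine eq_bot_or_eq_top_of_starProjection_eq_smul M z fun x => ?_
  refine Dense.eq_of_inner_right ℂ hc ?_
  rintro _ ⟨a, rfl⟩
  induction x using hc.induction_on with
  | hp => apply isClosed_eq <;> fun_prop
  | ih b =>
    -- At `a* b` the hypothesis reads `⟪π(a)c, P π(b)c⟫ = z ⟪π(a)c, π(b)c⟫`, as `P` is a
    -- self-adjoint idempotent commuting with `π`; by density `P = z`.
    have h1 := LinearMap.congr_fun h (star a * b)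
    rw [LinearMap.smul_apply, vectorFunctional_apply, vectorFunctional_apply, ← inner_rep_rep,
      ← inner_rep_rep, ← starProjection_rep M hM, ← starProjection_rep M hM,
      Submodule.inner_starProjection_left_eq_right,
      Submodule.starProjection_eq_self_iff.mpr (M.starProjection_apply_mem _)] at h1
    rw [inner_smul_right]
    exact h1

theorem vectorFunctional_sub_starProjection (M : Submodule ℂ H) [M.HasOrthogonalProjection]
    (hM : ∀ a : A, ∀ x ∈ M, π a x ∈ M) (c : H) :
    vectorFunctional π c = vectorFunctional π (M.starProjection c) +
      vectorFunctional π (c - M.starProjection c) := by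
  ext a
  have h1 : inner ℂ (M.starProjection c) (π a (c - M.starProjection c)) = 0 := by
    rw [← inner_rep_star_left]
    exact Submodule.inner_right_of_mem_orthogonal (hM _ _ (M.starProjection_apply_mem c))
      (M.sub_starProjection_mem_orthogonal c)
  have h2 : inner ℂ (c - M.starProjection c) (π a (M.starProjection c)) = 0 :=
    Submodule.inner_left_of_mem_orthogonal (hM _ _ (M.starProjection_apply_mem c))
      (M.sub_starProjection_mem_orthogonal c)
  rw [LinearMap.add_apply]
  simp only [vectorFunctional_apply]
  rw [map_sub, inner_sub_right] at h1
  rw [map_sub, inner_sub_right, inner_sub_left, inner_sub_left]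
  rw [inner_sub_left] at h2
  linear_combination h2 + h1

theorem exists_rep_ne_zero {c : H} (hc : DenseRange (orbitMap π c)) (hc1 : ‖c‖ = 1) :
    ∃ a, π a ≠ 0 := by
  by_contra! h
  have h1 : c = 0 := eq_zero_of_rep_eq_zero hc fun a => by simp [h a]
  simp [h1] at hc1

theorem IsIndecomposable.isIrreducible {c : H} (hc : DenseRange (orbitMap π c)) (hc1 : ‖c‖ = 1)
    (h : IsIndecomposable (vectorFunctional π c)) : IsIrreducible π := by
  refine ⟨exists_rep_ne_zero hc hc1, fun M hcl hM => ?_⟩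
  have : CompleteSpace M := hcl.completeSpace_coe
  obtain ⟨z, hz⟩ := h.eq_smul (vectorFunctional π (M.starProjection c))
    (isPositive_vectorFunctional _ _) (isHermitian_vectorFunctional _ _)
    ⟨_, norm_sq_mem_variationBounds _ _⟩ ⟨1, zero_le_one, by
      rw [Complex.ofReal_one, one_smul, vectorFunctional_sub_starProjection M hM c,
        add_sub_cancel_left]
      exact isPositive_vectorFunctional _ _⟩
  exact eq_bot_or_eq_top_of_vectorFunctional_eq_smul hc M hM hz

theorem IsIndecomposable.isPureState (h : IsIndecomposable ψ) (hψ : IsState ψ) :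
    IsPureState ψ := by
  refine mem_extremePoints_iff_left.mpr ⟨hψ, ?_⟩
  rintro φ₁ h₁ φ₂ h₂ ⟨s, t, hs, ht, -, hst⟩
  have h₁ : IsState φ₁ := h₁
  have h₂ : IsState φ₂ := h₂
  have hst' : ψ = (s : ℂ) • φ₁ + (t : ℂ) • φ₂ := by
    rw [← hst]
    ext a
    simp
  obtain ⟨v, hv⟩ := h₁.finiteVariation
  -- Subordinate with constant `1`: the difference `ψ - s φ₁` is the positive functional `t φ₂`.
  obtain ⟨z, hz⟩ := h.eq_smul ((s : ℂ) • φ₁) (h₁.positive.smul hs.le) (h₁.isHermitian.smul s)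
    ⟨_, mem_variationBounds_smul hv hs.le⟩ ⟨1, zero_le_one, by
      rw [Complex.ofReal_one, one_smul, hst', add_sub_cancel_left]
      exact h₂.positive.smul ht.le⟩
  have hs' : (s : ℂ) ≠ 0 := Complex.ofReal_ne_zero.mpr hs.ne'
  refine hψ.eq_of_eq_smul h₁ (z := (s : ℂ)⁻¹ * z) ?_
  rw [← smul_smul, ← hz, inv_smul_smul₀ hs']

theorem vectorFunctional_smul (π : A →⋆ₙₐ[ℂ] (H →L[ℂ] H)) (r : ℝ) (x : H) :
    vectorFunctional π ((r : ℂ) • x) = ((r ^ 2 : ℝ) : ℂ) • vectorFunctional π x := by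
  ext a
  simp [vectorFunctional_apply]
  ring

theorem mem_closure_range_orbitMap_of_comm {c : H} (hc : DenseRange (orbitMap π c))
    (S : H →L[ℂ] H) (hS : ∀ a y, S (π a y) = π a (S y)) :
    S c ∈ closure (Set.range (orbitMap π (S c))) := by
  have hmaps : Set.MapsTo S (Set.range (orbitMap π c)) (Set.range (orbitMap π (S c))) := by
    rintro _ ⟨a, rfl⟩
    exact ⟨a, (hS a c).symm⟩
  exact hmaps.closure S.continuous (hc c)

/-- Normalises `S c` to a unit vector. As `S` commutes with `π`, that vector lies in its own orbit
closure, so the variation is exactly `1`. -/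
theorem exists_isState_eq_smul (hπ : ∀ a, IsSelfAdjoint a → ‖π a‖ ≤ ‖a‖) {c : H}
    (hc : DenseRange (orbitMap π c)) (S : H →L[ℂ] H) (hS : ∀ a y, S (π a y) = π a (S y))
    (h0 : S c ≠ 0) :
    ∃ φ : A →ₗ[ℂ] ℂ, IsState φ ∧ vectorFunctional π (S c) = ((‖S c‖ ^ 2 : ℝ) : ℂ) • φ := by
  set r : ℝ := ‖S c‖ with hr
  have hr0 : 0 < r := norm_pos_iff.mpr h0
  have hrC : ((r⁻¹ : ℝ) : ℂ) • S c = (((r⁻¹ : ℝ) : ℂ) • S) c := rfl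
  refine ⟨vectorFunctional π (((r⁻¹ : ℝ) : ℂ) • S c), isState_vectorFunctional hπ ?_ ?_, ?_⟩
  · rw [hrC]
    exact mem_closure_range_orbitMap_of_comm hc _ fun a y => by simp [hS]
  · rw [norm_smul, Complex.norm_real, Real.norm_of_nonneg (by positivity), ← hr,
      inv_mul_cancel₀ hr0.ne']
  · rw [vectorFunctional_smul, smul_smul, ← Complex.ofReal_mul, ← mul_pow, mul_inv_cancel₀ hr0.ne',
      one_pow, Complex.ofReal_one, one_smul]

theorem IsPureState.isIrreducible (hπ : ∀ a, IsSelfAdjoint a → ‖π a‖ ≤ ‖a‖) {c : H}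
    (hc : DenseRange (orbitMap π c)) (hc1 : ‖c‖ = 1) (h : IsPureState (vectorFunctional π c)) :
    IsIrreducible π := by
  refine ⟨exists_rep_ne_zero hc hc1, fun M hcl hM => ?_⟩
  have : CompleteSpace M := hcl.completeSpace_coe
  have hdec := vectorFunctional_sub_starProjection M hM c
  -- If either component of `c` vanishes it cannot be normalised, but then the projected functional
  -- is `0` or `1` times the original one.
  by_cases h1 : M.starProjection c = 0
  · refine eq_bot_or_eq_top_of_vectorFunctional_eq_smul hc M hM (z := 0) ?_
    ext a
    simp [h1, vectorFunctional_apply]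
  by_cases h2 : c - M.starProjection c = 0
  · refine eq_bot_or_eq_top_of_vectorFunctional_eq_smul hc M hM (z := 1) ?_
    rw [← sub_eq_zero.mp h2, one_smul]
  obtain ⟨φ₁, hφ₁, e₁⟩ := exists_isState_eq_smul hπ hc M.starProjection
    (starProjection_rep M hM) h1
  obtain ⟨φ₂, hφ₂, e₂⟩ := exists_isState_eq_smul hπ hc (1 - M.starProjection)
    (fun a y => by simp [starProjection_rep M hM]) h2
  have e₂ : vectorFunctional π (c - M.starProjection c) =
    ((‖c - M.starProjection c‖ ^ 2 : ℝ) : ℂ) • φ₂ := e₂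
  have hsum : ‖M.starProjection c‖ ^ 2 + ‖c - M.starProjection c‖ ^ 2 = 1 := by
    have h3 := norm_add_sq_eq_norm_sq_add_norm_sq_of_inner_eq_zero (𝕜 := ℂ)
      (M.starProjection c) (c - M.starProjection c)
      (Submodule.inner_right_of_mem_orthogonal (M.starProjection_apply_mem c)
        (M.sub_starProjection_mem_orthogonal c))
    rw [add_sub_cancel, hc1] at h3
    linarith
  -- By Pythagoras the squared norms of the two components are the convex weights.
  have hseg : φ₁ = vectorFunctional π c := by
    refine (mem_extremePoints_iff_left.mp h).2 φ₁ hφ₁ φ₂ hφ₂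
      ⟨_, _, pow_pos (norm_pos_iff.mpr h1) 2, pow_pos (norm_pos_iff.mpr h2) 2, hsum, ?_⟩
    rw [hdec, e₁, e₂]
    ext a
    simp
  rw [hseg] at e₁
  exact eq_bot_or_eq_top_of_vectorFunctional_eq_smul hc M hM e₁

theorem tfae_vectorFunctional (hπ : ∀ a, IsSelfAdjoint a → ‖π a‖ ≤ ‖a‖) {c : H}
    (hc : DenseRange (orbitMap π c)) (hc1 : ‖c‖ = 1) :
    [IsIrreducible π, IsIndecomposable (vectorFunctional π c),
      IsPureState (vectorFunctional π c)].TFAE := by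
  tfae_have 1 → 2 := fun h => h.isIndecomposable hc
  tfae_have 2 → 3 := fun h => h.isPureState (isState_vectorFunctional hπ (hc c) hc1)
  tfae_have 3 → 1 := fun h => h.isIrreducible hπ hc hc1
  tfae_finish

theorem IsState.tfae (hψ : IsState ψ) :
    [IsIrreducible hψ.gns, IsIndecomposable ψ, IsPureState ψ].TFAE := by
  obtain ⟨c, hc, hc1, h⟩ := hψ.exists_cyclic
  have := tfae_vectorFunctional hψ.norm_gns_le_of_isSelfAdjoint hc hc1
  rwa [← h] at this

/-! ### σ-contractivity -/

theorem rLambda_le_norm (a : A) : rLambda a ≤ ‖a‖ := by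
  have h : BddBelow (Set.range fun n : ℕ => ‖powSucc a n‖ ^ (1 / ((n : ℝ) + 1))) :=
    ⟨0, by rintro _ ⟨n, rfl⟩; positivity⟩
  exact (ciInf_le h 0).trans_eq (by simp [powSucc])

/-- For `a = a*`, `r_σ(a)² = r_λ(a²) ≤ ‖a‖²`. -/
theorem IsSigmaContractive.norm_le_of_isSelfAdjoint (hπ : IsSigmaContractive π) (a : A)
    (ha : IsSelfAdjoint a) : ‖π a‖ ≤ ‖a‖ := by
  refine (hπ a).trans (Real.sqrt_le_iff.mpr ⟨norm_nonneg _, ?_⟩)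
  rw [ha.star_eq, sq]
  exact (rLambda_le_norm _).trans (norm_mul_le a a)

theorem map_powSucc (π : A →⋆ₙₐ[ℂ] (H →L[ℂ] H)) (a : A) (n : ℕ) :
    π (powSucc a n) = π a ^ (n + 1) := by
  induction n with
  | zero => simp [powSucc]
  | succ n ih => rw [powSucc, map_mul, ih, ← pow_succ]

theorem isSelfAdjoint_powSucc {a : A} (ha : IsSelfAdjoint a) (n : ℕ) :
    IsSelfAdjoint (powSucc a n) := by
  have hcomm : ∀ n, Commute (powSucc a n) a := by
    intro n
    induction n with
    | zero => exact Commute.refl a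
    | succ n ih => exact ih.mul_left (Commute.refl a)
  induction n with
  | zero => exact ha
  | succ n ih => exact (ih.commute_iff ha).mp (hcomm n)

theorem norm_pow_le_of_isSelfAdjoint {T : H →L[ℂ] H} (hT : IsSelfAdjoint T) (n : ℕ) :
    ‖T‖ ^ (n + 1) ≤ ‖T ^ (n + 1)‖ := by
  rcases (norm_nonneg T).eq_or_lt with h | h
  · rw [← h, zero_pow (Nat.succ_ne_zero n)]
    exact norm_nonneg _
  -- Pad to a power of two, `2 ^ (n + 1) = n + 1 + m`, where the norm is multiplicative on powers of
  -- `T`; then cancel `‖T‖ ^ m`.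
  obtain ⟨m, hm⟩ := Nat.exists_eq_add_of_le (Nat.lt_two_pow_self (n := n + 1)).le
  have h1 := hT.norm_pow_two_pow (n + 1)
  refine le_of_mul_le_mul_right ?_ (pow_pos h m)
  rw [← pow_add, ← hm, ← h1, hm, pow_add]
  refine (norm_mul_le _ _).trans ?_
  rcases m.eq_zero_or_pos with rfl | hm0
  · rw [pow_zero, pow_zero]
    exact mul_le_mul_of_nonneg_left ContinuousLinearMap.norm_id_le (norm_nonneg _)
  · gcongr
    exact norm_pow_le' T hm0

/-- With `h = a* a`, the C*-identity and self-adjointness give `‖π(a)‖^(2k) ≤ ‖π(h^k)‖ ≤ ‖h^k‖` for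
all `k ≥ 1`; take `k`-th roots and the infimum. -/
theorem isSigmaContractive_of_norm_le (hπ : ∀ a, IsSelfAdjoint a → ‖π a‖ ≤ ‖a‖) :
    IsSigmaContractive π := by
  intro a
  have hsa : IsSelfAdjoint (star a * a) := IsSelfAdjoint.star_mul_self a
  refine Real.le_sqrt_of_sq_le (le_ciInf fun n => ?_)
  have h1 : ‖π a‖ ^ 2 = ‖π (star a * a)‖ := by
    rw [map_mul, map_star, CStarRing.norm_star_mul_self, sq]
  have h2 : (‖π a‖ ^ 2) ^ (n + 1) ≤ ‖powSucc (star a * a) n‖ := by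
    rw [h1]
    refine (norm_pow_le_of_isSelfAdjoint (hsa.map π) n).trans ?_
    rw [← map_powSucc]
    exact hπ _ (isSelfAdjoint_powSucc hsa n)
  calc ‖π a‖ ^ 2 = ((‖π a‖ ^ 2) ^ (n + 1)) ^ (1 / ((n : ℝ) + 1)) := by
        rw [← Real.rpow_natCast (‖π a‖ ^ 2) (n + 1), ← Real.rpow_mul (by positivity)]
        push_cast
        rw [mul_one_div_cancel (by positivity), Real.rpow_one]
    _ ≤ _ := by gcongr

/-- Every irreducible σ-contractive representation is the GNS representation of a pure state. -/
theorem IsIrreducible.exists_isPureState (hirr : IsIrreducible π) (hσ : IsSigmaContractive π) :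
    ∃ (ψ : A →ₗ[ℂ] ℂ) (hψ : IsPureState ψ), SpatiallyEquivalent π hψ.isState.gns := by
  obtain ⟨a, ha⟩ := hirr.1
  obtain ⟨x, hx⟩ : ∃ x, π a x ≠ 0 := by
    by_contra! h
    exact ha (ContinuousLinearMap.ext h)
  have hx0 : x ≠ 0 := by
    rintro rfl
    exact hx (map_zero _)
  -- Any unit vector serves; `x` only witnesses that `H` is non-zero.
  obtain ⟨c, hc1⟩ : ∃ c : H, ‖c‖ = 1 :=
    ⟨((‖x‖⁻¹ : ℝ) : ℂ) • x, by
      rw [norm_smul, Complex.norm_real, norm_inv, norm_norm,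
        inv_mul_cancel₀ (norm_ne_zero_iff.mpr hx0)]⟩
  have hc : DenseRange (orbitMap π c) :=
    hirr.denseRange_orbitMap (norm_ne_zero_iff.mp (by rw [hc1]; exact one_ne_zero))
  have hpure : IsPureState (vectorFunctional π c) :=
    ((tfae_vectorFunctional hσ.norm_le_of_isSelfAdjoint hc hc1).out 0 2).mp hirr
  obtain ⟨d, hd, -, h⟩ := hpure.isState.exists_cyclic
  exact ⟨_, hpure, spatiallyEquivalent_of_vectorFunctional_eq hc hd h⟩

end States

end NormedStarAlg

end

theorem mainTheorem10 {A : Type*} [NonUnitalNormedRing A] [NormedSpace ℂ A]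
    [IsScalarTower ℂ A A] [SMulCommClass ℂ A A] [StarRing A] [StarModule ℂ A] :
    (∀ (ψ : A →ₗ[ℂ] ℂ) (hψ : NormedStarAlg.IsState ψ),
      [NormedStarAlg.IsIrreducible hψ.gns,
        NormedStarAlg.IsIndecomposable ψ,
        NormedStarAlg.IsPureState ψ].TFAE) ∧
    (∀ (ψ : A →ₗ[ℂ] ℂ) (hψ : NormedStarAlg.IsPureState ψ),
      NormedStarAlg.IsIrreducible hψ.isState.gns ∧
        NormedStarAlg.IsSigmaContractive hψ.isState.gns) ∧
    (∀ (H : Type*) [NormedAddCommGroup H] [InnerProductSpace ℂ H] [CompleteSpace H]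
      (π : A →⋆ₙₐ[ℂ] (H →L[ℂ] H)),
      NormedStarAlg.IsIrreducible π → NormedStarAlg.IsSigmaContractive π →
        ∃ (ψ : A →ₗ[ℂ] ℂ) (hψ : NormedStarAlg.IsPureState ψ),
          NormedStarAlg.SpatiallyEquivalent π hψ.isState.gns) :=
  ⟨fun _ hψ => hψ.tfae,
    fun _ hψ => ⟨(hψ.isState.tfae.out 2 0).mp hψ,
      NormedStarAlg.isSigmaContractive_of_norm_le hψ.isState.norm_gns_le_of_isSelfAdjoint⟩,
    fun _ _ _ _ _ hirr hσ => hirr.exists_isPureState hσ⟩
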